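/- Let LJ$^+$ be Gentzen's intuitionistic sequent calculus LJ for first-order formulas without function symbols and object constants (connectives $\&,\vee,\neg,\supset$, quantifiers $\forall,\exists$, constants $\top,\bot$; sequents have at most one formula in the succedent; structural rules are thinning, contraction, exchange and cut), with the axioms $A\vdash A$, $\;\vdash\top$ and $\bot\vdash$, extended by the neutralization rule $$\frac{N,\Gamma\vdash\Lambda\qquad \neg N,\Gamma\vdash\Lambda}{\Gamma\vdash\Lambda}\qquad (N \text{ a propositional formula, i.e. built by propositional connectives from symbols of arity } 0 \text{ and } \top,\bot).$$ A formula $F$ is derivable in LJ$^+$ if the sequent $\vdash F$ has a derivation. Theorem (weak existence property). Suppose that $\exists x\,A(x)$ is derivable in LJ$^+$. Then there are $n\ge 1$ and variables $t_1,\dots,t_n$ such that $A(t_1)\vee\dots\vee A(t_n)$ is derivable in LJ$^+$. Moreover, the disjunction can be read off from a derivation without cut: the sequent $\vdash\exists x\,A(x)$ has a derivation in LJ$^+$ in which the cut rule does not occur, and for every such cut-free derivation the variables $t_1,\dots,t_n$ ($n\ge 1$) can be chosen so that each $A(t_i)$ is the succedent of the premise of an inference of that derivation by which $\exists x\,A(x)$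 is introduced in the succedent. -/

import Mathlib

namespace LJPlus

universe u

/-- Variables available under `n` quantifiers. Free and bound variables are kept apart, as in
Gentzen's calculus: free variables are named by natural numbers, and `bound i` refers to the
quantifier at depth `i`, counted from the outermost one. -/
inductive Var (n : ℕ) : Type
  | free (a : ℕ) : Var n
  | bound (i : Fin n) : Var n

/-- First-order formulas without function symbols and object constants, lying under `n`
quantifiers. `Sym k` is the type of symbols of arity `k`: the elements of `Sym 0` are the
propositional symbols, those of `Sym (k + 1)` are predicate symbols. A formula in the usual
sense is an element of `Formula Sym 0`; an element of `Formula Sym 1` is a formula `A(x)` in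
which the free places of the bound variable `x` are marked. -/
inductive Formula (Sym : ℕ → Type u) : ℕ → Type u
  | atom {n k : ℕ} (R : Sym k) (v : Fin k → Var n) : Formula Sym n
  | top {n : ℕ} : Formula Sym n
  | bot {n : ℕ} : Formula Sym n
  | and {n : ℕ} (A B : Formula Sym n) : Formula Sym n
  | or {n : ℕ} (A B : Formula Sym n) : Formula Sym n
  | neg {n : ℕ} (A : Formula Sym n) : Formula Sym n
  | imp {n : ℕ} (A B : Formula Sym n) : Formula Sym n
  | all {n : ℕ} (A : Formula Sym (n + 1)) : Formula Sym n
  | ex {n : ℕ} (A : Formula Sym (n + 1)) : Formula Sym n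

/-- Replace the outermost bound variable by the free variable `a`. -/
def Var.inst {n : ℕ} (a : ℕ) : Var (n + 1) → Var n
  | .free b => .free b
  | .bound i => Fin.cases (.free a) (fun j => .bound j) i

variable {Sym : ℕ → Type u}

namespace Formula

/-- `A.inst a` is `A(a)`: the outermost bound variable is replaced by the free variable `a`. -/
def inst (a : ℕ) : {n : ℕ} → Formula Sym (n + 1) → Formula Sym n
  | _, .atom R v => .atom R (fun i => (v i).inst a)
  | _, .top => .top
  | _, .bot => .bot
  | _, .and A B => .and (A.inst a) (B.inst a)
  | _, .or A B => .or (A.inst a) (B.inst a)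
  | _, .neg A => .neg (A.inst a)
  | _, .imp A B => .imp (A.inst a) (B.inst a)
  | _, .all A => .all (A.inst a)
  | _, .ex A => .ex (A.inst a)

/-- The free variable `a` occurs in the formula. -/
def Occurs (a : ℕ) : {n : ℕ} → Formula Sym n → Prop
  | _, .atom _ v => ∃ i, v i = .free a
  | _, .top => False
  | _, .bot => False
  | _, .and A B => A.Occurs a ∨ B.Occurs a
  | _, .or A B => A.Occurs a ∨ B.Occurs a
  | _, .neg A => A.Occurs a
  | _, .imp A B => A.Occurs a ∨ B.Occurs a
  | _, .all A => A.Occurs a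
  | _, .ex A => A.Occurs a

/-- Propositional formulas: built from propositional symbols (and the constants) by the
propositional connectives. -/
def IsPropositional : {n : ℕ} → Formula Sym n → Prop
  | _, .atom (k := k) _ _ => k = 0
  | _, .top => True
  | _, .bot => True
  | _, .and A B => A.IsPropositional ∧ B.IsPropositional
  | _, .or A B => A.IsPropositional ∧ B.IsPropositional
  | _, .neg A => A.IsPropositional
  | _, .imp A B => A.IsPropositional ∧ B.IsPropositional
  | _, .all _ => False
  | _, .ex _ => False

/-- `A.disj t [t₂, …, tₙ]` is `A(t) ∨ (A(t₂) ∨ (… ∨ A(tₙ)))`. -/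
def disj (A : Formula Sym 1) : ℕ → List ℕ → Formula Sym 0
  | t, [] => A.inst t
  | t, s :: ts => .or (A.inst t) (A.disj s ts)

end Formula

/-- Derivations (proof trees) of the sequent calculus LJ+. The antecedent is a finite sequence of
formulas, the succedent is a formula (`some A`) or empty (`none`). All constructors except
`neutralization` form Gentzen's LJ with the constants for truth and falsity. -/
inductive Derivation :
    List (Formula Sym 0) → Option (Formula Sym 0) → Type u
  | ax (A : Formula Sym 0) : Derivation [A] (some A)
  | topR : Derivation [] (some .top)
  | botL : Derivation [.bot] none
  | thinL {Γ Λ} (A : Formula Sym 0) (d : Derivation Γ Λ) : Derivation (A :: Γ) Λ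
  | thinR {Γ} (A : Formula Sym 0) (d : Derivation Γ none) : Derivation Γ (some A)
  | contr {A Γ Λ} (d : Derivation (A :: A :: Γ) Λ) : Derivation (A :: Γ) Λ
  | exch {Γ A B Δ Λ} (d : Derivation (Γ ++ A :: B :: Δ) Λ) : Derivation (Γ ++ B :: A :: Δ) Λ
  | cut {Γ Δ C Λ} (d : Derivation Γ (some C)) (e : Derivation (C :: Δ) Λ) : Derivation (Γ ++ Δ) Λ
  | andR {Γ A B} (d : Derivation Γ (some A)) (e : Derivation Γ (some B)) :
      Derivation Γ (some (.and A B))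
  | andL₁ {A Γ Λ} (B : Formula Sym 0) (d : Derivation (A :: Γ) Λ) : Derivation (.and A B :: Γ) Λ
  | andL₂ {B Γ Λ} (A : Formula Sym 0) (d : Derivation (B :: Γ) Λ) : Derivation (.and A B :: Γ) Λ
  | orL {A B Γ Λ} (d : Derivation (A :: Γ) Λ) (e : Derivation (B :: Γ) Λ) :
      Derivation (.or A B :: Γ) Λ
  | orR₁ {Γ A} (B : Formula Sym 0) (d : Derivation Γ (some A)) : Derivation Γ (some (.or A B))
  | orR₂ {Γ B} (A : Formula Sym 0) (d : Derivation Γ (some B)) : Derivation Γ (some (.or A B))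
  | negR {A Γ} (d : Derivation (A :: Γ) none) : Derivation Γ (some (.neg A))
  | negL {A Γ} (d : Derivation Γ (some A)) : Derivation (.neg A :: Γ) none
  | impR {A Γ B} (d : Derivation (A :: Γ) (some B)) : Derivation Γ (some (.imp A B))
  | impL {Γ A B Δ Λ} (d : Derivation Γ (some A)) (e : Derivation (B :: Δ) Λ) :
      Derivation (.imp A B :: (Γ ++ Δ)) Λ
  | allR {Γ} (F : Formula Sym 1) (a : ℕ) (hΓ : ∀ G ∈ Γ, ¬ G.Occurs a) (hF : ¬ F.Occurs a)
      (d : Derivation Γ (some (F.inst a))) : Derivation Γ (some (.all F))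
  | allL {Γ Λ} (F : Formula Sym 1) (a : ℕ) (d : Derivation (F.inst a :: Γ) Λ) :
      Derivation (.all F :: Γ) Λ
  | exR {Γ} (F : Formula Sym 1) (a : ℕ) (d : Derivation Γ (some (F.inst a))) :
      Derivation Γ (some (.ex F))
  | exL {Γ Λ} (F : Formula Sym 1) (a : ℕ) (hF : ¬ F.Occurs a) (hΓ : ∀ G ∈ Γ, ¬ G.Occurs a)
      (hΛ : ∀ G ∈ Λ, ¬ G.Occurs a) (d : Derivation (F.inst a :: Γ) Λ) :
      Derivation (.ex F :: Γ) Λ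
  | neutralization {Γ Λ} (N : Formula Sym 0) (hN : N.IsPropositional)
      (d : Derivation (N :: Γ) Λ) (e : Derivation (.neg N :: Γ) Λ) : Derivation Γ Λ

namespace Derivation

/-- The cut rule does not occur in the derivation. -/
def CutFree : {Γ : List (Formula Sym 0)} → {Λ : Option (Formula Sym 0)} → Derivation Γ Λ → Prop
  | _, _, .ax _ => True
  | _, _, .topR => True
  | _, _, .botL => True
  | _, _, .thinL _ d => d.CutFree
  | _, _, .thinR _ d => d.CutFree
  | _, _, .contr d => d.CutFree
  | _, _, .exch d => d.CutFree
  | _, _, .cut _ _ => False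
  | _, _, .andR d e => d.CutFree ∧ e.CutFree
  | _, _, .andL₁ _ d => d.CutFree
  | _, _, .andL₂ _ d => d.CutFree
  | _, _, .orL d e => d.CutFree ∧ e.CutFree
  | _, _, .orR₁ _ d => d.CutFree
  | _, _, .orR₂ _ d => d.CutFree
  | _, _, .negR d => d.CutFree
  | _, _, .negL d => d.CutFree
  | _, _, .impR d => d.CutFree
  | _, _, .impL d e => d.CutFree ∧ e.CutFree
  | _, _, .allR _ _ _ _ d => d.CutFree
  | _, _, .allL _ _ d => d.CutFree
  | _, _, .exR _ _ d => d.CutFree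
  | _, _, .exL _ _ _ _ _ d => d.CutFree
  | _, _, .neutralization _ _ d e => d.CutFree ∧ e.CutFree

/-- `d.HasWitness A t`: somewhere in `d` the succedent `∃x A(x)` is inferred from the succedent
`A(t)` by the rule introducing the existential quantifier in the succedent. -/
def HasWitness (A : Formula Sym 1) (t : ℕ) :
    {Γ : List (Formula Sym 0)} → {Λ : Option (Formula Sym 0)} → Derivation Γ Λ → Prop
  | _, _, .ax _ => False
  | _, _, .topR => False
  | _, _, .botL => False
  | _, _, .thinL _ d => d.HasWitness A t
  | _, _, .thinR _ d => d.HasWitness A t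
  | _, _, .contr d => d.HasWitness A t
  | _, _, .exch d => d.HasWitness A t
  | _, _, .cut d e => d.HasWitness A t ∨ e.HasWitness A t
  | _, _, .andR d e => d.HasWitness A t ∨ e.HasWitness A t
  | _, _, .andL₁ _ d => d.HasWitness A t
  | _, _, .andL₂ _ d => d.HasWitness A t
  | _, _, .orL d e => d.HasWitness A t ∨ e.HasWitness A t
  | _, _, .orR₁ _ d => d.HasWitness A t
  | _, _, .orR₂ _ d => d.HasWitness A t
  | _, _, .negR d => d.HasWitness A t
  | _, _, .negL d => d.HasWitness A t
  | _, _, .impR d => d.HasWitness A t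
  | _, _, .impL d e => d.HasWitness A t ∨ e.HasWitness A t
  | _, _, .allR _ _ _ _ d => d.HasWitness A t
  | _, _, .allL _ _ d => d.HasWitness A t
  | _, _, .exR F a d => (F = A ∧ a = t) ∨ d.HasWitness A t
  | _, _, .exL _ _ _ _ _ d => d.HasWitness A t
  | _, _, .neutralization _ _ d e => d.HasWitness A t ∨ e.HasWitness A t

end Derivation

/-- The formula `A` is derivable in LJ+: the sequent with empty antecedent and succedent `A` has a
derivation. -/
def Derivable (A : Formula Sym 0) : Prop :=
  Nonempty (Derivation [] (some A))

end LJPlus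

/-!
Formulas are interpreted in frames. The neutralization rule is sound as soon as the propositional
symbols take complemented values, since the values of propositional formulas are then complemented
as well.

Call a set of lists `Γ` closed if it is an intersection of sets of the form `{Γ | Γ, Δ ⊢ Λ}`, where
`⊢` is provability without cut. The closed sets form a frame (this only uses the structural rules),
and if atomic formulas take as value the set of lists which prove them, then every list in the value
of `A` proves `A`, and the list `A` belongs to the value of `A`. Hence a sequent valid in this model
is provable without cut. Reading all atoms as true shows that the empty sequent is not provable.

In a cut-free derivation of `⊢ ∃x A(x)`, above the root and as long as the succedent remains
`∃x A(x)`, only neutralized formulas and their subformulas enter the antecedent. They are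
propositional, so that no quantifier is introduced in the antecedent, and the succedent can be
replaced throughout by any succedent which follows from every `A(t)` from which `∃x A(x)` is
inferred. This is the disjunction of these `A(t)`, or the empty succedent if there are none, which
is impossible.
-/

namespace LJPlus

variable {Sym : ℕ → Type*}

section Heyting

variable {H : Type*} [HeytingAlgebra H] {a b : H}

theorem isComplemented_compl (ha : IsComplemented a) : IsComplemented aᶜ := by
  obtain ⟨a', h⟩ := ha
  exact ⟨a, h.compl_eq ▸ h.symm⟩

theorem isComplemented_himp (ha : IsComplemented a) (hb : IsComplemented b) :
    IsComplemented (a ⇨ b) := by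
  obtain ⟨a', h⟩ := ha
  have himp_eq : a ⇨ b = b ⊔ a' :=
    eq_of_forall_le_iff fun c => le_himp_iff.trans h.le_sup_right_iff_inf_left_le.symm
  exact himp_eq ▸ hb.sup ⟨a, h.symm⟩

theorem le_of_inf_le_of_compl_inf_le {c : H} (ha : IsComplemented a) (h : a ⊓ b ≤ c)
    (h' : aᶜ ⊓ b ≤ c) : b ≤ c := by
  obtain ⟨a', ha'⟩ := ha
  calc b = a ⊓ b ⊔ aᶜ ⊓ b := by rw [← inf_sup_right, ha'.compl_eq, ha'.sup_eq_top, top_inf_eq]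
    _ ≤ c := sup_le h h'

end Heyting

/-! ### Frame-valued semantics -/

/-- An interpretation of the symbols of arity `k` by `k`-ary relations on a domain `D`, with truth
values in `H`. -/
structure Interpretation (Sym : ℕ → Type*) (D H : Type*) where
  rel : ∀ {k : ℕ}, Sym k → (Fin k → D) → H

/-- The value of a variable when `ρ` assigns values to the free variables and `β` to the bound
ones. -/
def Var.eval {D : Type*} {n : ℕ} (ρ : ℕ → D) (β : Fin n → D) : Var n → D
  | .free a => ρ a
  | .bound i => β i

theorem Var.eval_inst {D : Type*} {n : ℕ} (ρ : ℕ → D) (β : Fin n → D) (a : ℕ) (x : Var (n + 1)) :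
    (x.inst a).eval ρ β = x.eval ρ (Fin.cons (ρ a) β) := by
  cases x with
  | free b => rfl
  | bound i => cases i using Fin.cases <;> rfl

namespace Interpretation

variable {D H : Type*} [Order.Frame H]

/-- The truth value of a formula when `ρ` assigns values to the free variables and `β` to the bound
ones. A quantifier is the innermost one for its body, hence binds the last place of `β`. -/
def eval (I : Interpretation Sym D H) (ρ : ℕ → D) : {n : ℕ} → Formula Sym n → (Fin n → D) → H
  | _, .atom R v, β => I.rel R fun i => (v i).eval ρ β
  | _, .top, _ => ⊤
  | _, .bot, _ => ⊥
  | _, .and A B, β => I.eval ρ A β ⊓ I.eval ρ B β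
  | _, .or A B, β => I.eval ρ A β ⊔ I.eval ρ B β
  | _, .neg A, β => (I.eval ρ A β)ᶜ
  | _, .imp A B, β => I.eval ρ A β ⇨ I.eval ρ B β
  | _, .all A, β => ⨅ t, I.eval ρ A (Fin.snoc β t)
  | _, .ex A, β => ⨆ t, I.eval ρ A (Fin.snoc β t)

variable (I : Interpretation Sym D H)

theorem eval_inst (ρ : ℕ → D) (a : ℕ) : ∀ {n : ℕ} (A : Formula Sym (n + 1)) (β : Fin n → D),
    I.eval ρ (A.inst a) β = I.eval ρ A (Fin.cons (ρ a) β)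
  | _, .atom R v, β => by simp only [Formula.inst, eval, Var.eval_inst]
  | _, .top, _ | _, .bot, _ => by simp only [Formula.inst, eval]
  | _, .and A B, β | _, .or A B, β | _, .imp A B, β => by
    simp only [Formula.inst, eval, eval_inst ρ a A, eval_inst ρ a B]
  | _, .neg A, β => by simp only [Formula.inst, eval, eval_inst ρ a A]
  | _, .all A, β | _, .ex A, β => by
    simp only [Formula.inst, eval, eval_inst ρ a A, Fin.cons_snoc_eq_snoc_cons]

theorem eval_update_of_not_occurs (ρ : ℕ → D) {a : ℕ} (t : D) {n : ℕ} {A : Formula Sym n}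
    (h : ¬ A.Occurs a) (β : Fin n → D) : I.eval (Function.update ρ a t) A β = I.eval ρ A β := by
  induction A with
  | atom R v =>
    have hv (i) : (v i).eval (Function.update ρ a t) β = (v i).eval ρ β := by
      cases hi : v i with
      | free b => exact Function.update_of_ne (by rintro rfl; exact h ⟨i, hi⟩) _ _
      | bound j => rfl
    simp only [eval, hv]
  | top | bot => rfl
  | and _ _ ihA ihB | or _ _ ihA ihB | imp _ _ ihA ihB =>
    obtain ⟨hA, hB⟩ := not_or.1 h
    simp only [eval, ihA hA, ihB hB]
  | neg _ ih | all _ ih | ex _ ih => simp only [eval, ih h]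

theorem eval_all (ρ : ℕ → D) (F : Formula Sym 1) :
    I.eval ρ (.all F) ![] = ⨅ t, I.eval ρ F ![t] := by
  simp only [eval, Fin.snoc_zero]
  congr! with t i
  simp

theorem eval_ex (ρ : ℕ → D) (F : Formula Sym 1) :
    I.eval ρ (.ex F) ![] = ⨆ t, I.eval ρ F ![t] := by
  simp only [eval, Fin.snoc_zero]
  congr! with t i
  simp

theorem eval_all_le_eval_inst (ρ : ℕ → D) (F : Formula Sym 1) (a : ℕ) :
    I.eval ρ (.all F) ![] ≤ I.eval ρ (F.inst a) ![] := by
  rw [eval_all, eval_inst]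
  exact iInf_le _ (ρ a)

theorem eval_inst_le_eval_ex (ρ : ℕ → D) (F : Formula Sym 1) (a : ℕ) :
    I.eval ρ (F.inst a) ![] ≤ I.eval ρ (.ex F) ![] := by
  rw [eval_ex, eval_inst]
  exact le_iSup (fun t => I.eval ρ F ![t]) (ρ a)

theorem eval_inst_update (ρ : ℕ → D) {a : ℕ} (t : D) {F : Formula Sym 1} (hF : ¬ F.Occurs a) :
    I.eval (Function.update ρ a t) (F.inst a) ![] = I.eval ρ F ![t] := by
  rw [eval_inst, Function.update_self, eval_update_of_not_occurs I ρ t hF]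
  rfl

/-- The truth value of an antecedent, read as a conjunction. -/
def evalAntecedent (ρ : ℕ → D) (Γ : List (Formula Sym 0)) : H :=
  ⨅ G ∈ Γ, I.eval ρ G ![]

/-- The truth value of a succedent, read as a disjunction with at most one member. -/
def evalSuccedent (ρ : ℕ → D) (Λ : Option (Formula Sym 0)) : H :=
  ⨆ G ∈ Λ, I.eval ρ G ![]

section Sequents

variable (ρ : ℕ → D)

@[simp]
theorem evalAntecedent_nil : I.evalAntecedent ρ [] = ⊤ := by
  simp [evalAntecedent]

@[simp]
theorem evalAntecedent_cons (A : Formula Sym 0) (Γ : List (Formula Sym 0)) :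
    I.evalAntecedent ρ (A :: Γ) = I.eval ρ A ![] ⊓ I.evalAntecedent ρ Γ := by
  simp [evalAntecedent, iInf_or, iInf_inf_eq]

@[simp]
theorem evalAntecedent_append (Γ Δ : List (Formula Sym 0)) :
    I.evalAntecedent ρ (Γ ++ Δ) = I.evalAntecedent ρ Γ ⊓ I.evalAntecedent ρ Δ := by
  simp [evalAntecedent, iInf_or, iInf_inf_eq]

@[simp]
theorem evalSuccedent_none : I.evalSuccedent ρ none = ⊥ := by
  simp [evalSuccedent]

@[simp]
theorem evalSuccedent_some (A : Formula Sym 0) :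
    I.evalSuccedent ρ (some A) = I.eval ρ A ![] := by
  simp [evalSuccedent]

theorem evalAntecedent_update {a : ℕ} (t : D) {Γ : List (Formula Sym 0)}
    (h : ∀ G ∈ Γ, ¬ G.Occurs a) :
    I.evalAntecedent (Function.update ρ a t) Γ = I.evalAntecedent ρ Γ :=
  biInf_congr fun G hG => I.eval_update_of_not_occurs ρ t (h G hG) _

theorem evalSuccedent_update {a : ℕ} (t : D) {Λ : Option (Formula Sym 0)}
    (h : ∀ G ∈ Λ, ¬ G.Occurs a) :
    I.evalSuccedent (Function.update ρ a t) Λ = I.evalSuccedent ρ Λ :=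
  biSup_congr fun G hG => I.eval_update_of_not_occurs ρ t (h G hG) _

end Sequents

/-- Propositional symbols take complemented truth values. This is what makes the neutralization
rule sound. -/
def IsNeutral : Prop :=
  ∀ (P : Sym 0) (v : Fin 0 → D), IsComplemented (I.rel P v)

variable {I}

theorem IsNeutral.isComplemented_eval (hI : I.IsNeutral) (ρ : ℕ → D) {n : ℕ} {A : Formula Sym n}
    (hA : A.IsPropositional) (β : Fin n → D) : IsComplemented (I.eval ρ A β) := by
  induction A with
  | atom R v => obtain rfl : _ = 0 := hA; exact hI R _
  | top => exact isComplemented_top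
  | bot => exact isComplemented_bot
  | and _ _ ihA ihB => exact (ihA hA.1 β).inf (ihB hA.2 β)
  | or _ _ ihA ihB => exact (ihA hA.1 β).sup (ihB hA.2 β)
  | neg _ ih => exact isComplemented_compl (ih hA β)
  | imp _ _ ihA ihB => exact isComplemented_himp (ihA hA.1 β) (ihB hA.2 β)
  | all | ex => exact hA.elim

end Interpretation

open Interpretation in
theorem Derivation.evalAntecedent_le_evalSuccedent {D H : Type*} [Order.Frame H]
    {I : Interpretation Sym D H} (hI : I.IsNeutral) {Γ : List (Formula Sym 0)}
    {Λ : Option (Formula Sym 0)} (d : Derivation Γ Λ) (ρ : ℕ → D) :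
    I.evalAntecedent ρ Γ ≤ I.evalSuccedent ρ Λ := by
  induction d generalizing ρ <;>
    simp only [evalAntecedent_nil, evalAntecedent_cons, evalAntecedent_append, evalSuccedent_none,
      evalSuccedent_some, eval_all, eval_ex] at *
  case ax => exact inf_le_left
  case topR => exact le_rfl
  case botL => exact inf_le_left
  case thinL ih => exact inf_le_right.trans (ih ρ)
  case thinR ih => exact (ih ρ).trans bot_le
  case contr ih => simpa only [← inf_assoc, inf_idem] using ih ρ
  case exch ih => simpa only [inf_left_comm] using ih ρ
  case cut ihd ihe => exact (inf_le_inf_right _ (ihd ρ)).trans (ihe ρ)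
  case andR ihd ihe => exact le_inf (ihd ρ) (ihe ρ)
  case andL₁ ih => exact (inf_le_inf_right _ inf_le_left).trans (ih ρ)
  case andL₂ ih => exact (inf_le_inf_right _ inf_le_right).trans (ih ρ)
  case orL ihd ihe =>
    simp only [eval, inf_sup_right]
    exact sup_le (ihd ρ) (ihe ρ)
  case orR₁ ih => exact (ih ρ).trans le_sup_left
  case orR₂ ih => exact (ih ρ).trans le_sup_right
  case negR ih => exact le_compl_iff_disjoint_left.2 (disjoint_iff_inf_le.2 (ih ρ))
  case negL ih => exact (inf_le_inf_left _ (ih ρ)).trans (compl_inf_self _).le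
  case impR ih => exact le_himp_iff'.2 (ih ρ)
  case impL ihd ihe =>
    rw [← inf_assoc]
    exact (inf_le_inf_right _ ((inf_le_inf_left _ (ihd ρ)).trans himp_inf_le)).trans (ihe ρ)
  case allR F a hΓ hF _ ih =>
    refine le_iInf fun t => ?_
    simpa only [I.evalAntecedent_update ρ t hΓ, I.eval_inst_update ρ t hF]
      using ih (Function.update ρ a t)
  case allL F a _ ih =>
    rw [← eval_all]
    exact (inf_le_inf_right _ (I.eval_all_le_eval_inst ρ F a)).trans (ih ρ)
  case exR F a _ ih =>
    rw [← eval_ex]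
    exact (ih ρ).trans (I.eval_inst_le_eval_ex ρ F a)
  case exL F a hF hΓ hΛ _ ih =>
    rw [iSup_inf_eq]
    refine iSup_le fun t => ?_
    simpa only [I.evalAntecedent_update ρ t hΓ, I.evalSuccedent_update ρ t hΛ,
      I.eval_inst_update ρ t hF] using ih (Function.update ρ a t)
  case neutralization hN _ _ ihd ihe =>
    exact le_of_inf_le_of_compl_inf_le (hI.isComplemented_eval ρ hN ![]) (ihd ρ) (ihe ρ)

/-! ### Cut-free provability -/

namespace Formula

theorem finite_setOf_occurs {n : ℕ} (A : Formula Sym n) : {a | A.Occurs a}.Finite := by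
  induction A with
  | atom _ v =>
    exact ((Set.finite_range v).preimage fun _ _ _ _ => Var.free.inj : (Var.free ⁻¹' _).Finite)
  | top | bot => exact Set.finite_empty
  | and _ _ ihA ihB | or _ _ ihA ihB | imp _ _ ihA ihB => exact ihA.union ihB
  | neg _ ih | all _ ih | ex _ ih => exact ih

theorem exists_fresh {n : ℕ} (F : Formula Sym n) (Γ : List (Formula Sym 0)) :
    ∃ a, ¬ F.Occurs a ∧ ∀ G ∈ Γ, ¬ G.Occurs a := by
  have hfin : ({a | F.Occurs a} ∪ ⋃ G ∈ {G | G ∈ Γ}, {a | G.Occurs a}).Finite :=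
    F.finite_setOf_occurs.union (Γ.finite_toSet.biUnion fun G _ => G.finite_setOf_occurs)
  obtain ⟨a, ha⟩ := hfin.exists_notMem
  exact ⟨a, by simpa using ha⟩

end Formula

/-- The sequent `Γ ⊢ Λ` has a derivation without cut. -/
def CutFreeProvable (Γ : List (Formula Sym 0)) (Λ : Option (Formula Sym 0)) : Prop :=
  ∃ d : Derivation Γ Λ, d.CutFree

namespace CutFreeProvable

variable {Γ Δ : List (Formula Sym 0)} {Λ : Option (Formula Sym 0)} {A : Formula Sym 0}

theorem append_perm (h : Γ.Perm Δ) (Θ : List (Formula Sym 0)) :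
    CutFreeProvable (Θ ++ Γ) Λ → CutFreeProvable (Θ ++ Δ) Λ := by
  induction h generalizing Θ with
  | nil => exact id
  | cons G _ ih => simpa only [List.append_assoc, List.singleton_append] using ih (Θ ++ [G])
  | swap => exact fun ⟨d, hd⟩ => ⟨d.exch, hd⟩
  | trans _ _ ih₁ ih₂ => exact ih₂ Θ ∘ ih₁ Θ

theorem perm (h : Γ.Perm Δ) (hΓ : CutFreeProvable Γ Λ) : CutFreeProvable Δ Λ :=
  append_perm h [] hΓ

theorem of_cons_of_mem (h : A ∈ Γ) (hΓ : CutFreeProvable (A :: Γ) Λ) : CutFreeProvable Γ Λ := by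
  obtain ⟨Γ₁, Γ₂, rfl⟩ := List.append_of_mem h
  have hperm : (Γ₁ ++ A :: Γ₂).Perm (A :: (Γ₁ ++ Γ₂)) := List.perm_middle
  obtain ⟨d, hd⟩ := hΓ.perm (hperm.cons A)
  exact perm hperm.symm ⟨d.contr, hd⟩

theorem of_append_of_subset {Θ : List (Formula Sym 0)} (h : Θ ⊆ Γ)
    (hΓ : CutFreeProvable (Θ ++ Γ) Λ) : CutFreeProvable Γ Λ := by
  induction Θ with
  | nil => exact hΓ
  | cons A Θ ih =>
    obtain ⟨hA, hΘ⟩ := List.cons_subset.1 h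
    exact ih hΘ (hΓ.of_cons_of_mem (List.mem_append_right _ hA))

theorem append_left (Θ : List (Formula Sym 0)) (hΓ : CutFreeProvable Γ Λ) :
    CutFreeProvable (Θ ++ Γ) Λ := by
  induction Θ with
  | nil => exact hΓ
  | cons A Θ ih => exact let ⟨d, hd⟩ := ih; ⟨d.thinL A, hd⟩

theorem mono (h : Γ ⊆ Δ) (hΓ : CutFreeProvable Γ Λ) : CutFreeProvable Δ Λ :=
  of_append_of_subset h ((hΓ.append_left Δ).perm List.perm_append_comm)

theorem of_none (Λ : Option (Formula Sym 0)) (h : CutFreeProvable Γ none) :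
    CutFreeProvable Γ Λ :=
  match Λ, h with
  | none, h => h
  | some A, ⟨d, hd⟩ => ⟨d.thinR A, hd⟩

end CutFreeProvable

/-! ### The frame of concepts of an entailment relation -/

section EntailmentConcepts

variable {F S : Type*} {E : List F → S → Prop}

/-- The concepts of the relation `E (Γ ++ Δ) s` between a list `Γ` of hypotheses and a context
`(Δ, s)` for it: the extents are the intersections of sets of the form `{Γ | E (Γ ++ Δ) s}`. For
cut-free provability they are the truth values of the model which proves cut elimination. -/
abbrev EntailmentConcept (E : List F → S → Prop) : Type _ :=
  Concept (List F) (List F × S) fun Γ p => E (Γ ++ p.1) p.2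

namespace EntailmentConcept

variable {c : EntailmentConcept E} {Γ Δ Θ : List F} {s : S}

theorem mem_extent_iff : Γ ∈ c.extent ↔ ∀ Δ s, (Δ, s) ∈ c.intent → E (Γ ++ Δ) s := by
  rw [← c.lowerPolar_intent, mem_lowerPolar_iff, Prod.forall]

theorem mem_intent_iff : (Δ, s) ∈ c.intent ↔ ∀ Γ ∈ c.extent, E (Γ ++ Δ) s := by
  rw [← c.upperPolar_extent, mem_upperPolar_iff]

theorem mem_extent_ofObject_iff :
    Γ ∈ (Concept.ofObject _ Θ : EntailmentConcept E).extent ↔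
      ∀ Δ s, E (Θ ++ Δ) s → E (Γ ++ Δ) s := by
  simp [mem_lowerPolar_iff, mem_upperPolar_iff]

theorem mem_extent_of_subset (hE : ∀ {Γ Δ : List F} {s : S}, Γ ⊆ Δ → E Γ s → E Δ s)
    (h : Γ ⊆ Δ) (hΓ : Γ ∈ c.extent) : Δ ∈ c.extent :=
  mem_extent_iff.2 fun Θ s hΘ => hE (by grind) (mem_extent_iff.1 hΓ Θ s hΘ)

theorem frameMinimalAxioms (hE : ∀ {Γ Δ : List F} {s : S}, Γ ⊆ Δ → E Γ s → E Δ s) :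
    Order.Frame.MinimalAxioms (EntailmentConcept E) where
  inf_sSup_le_iSup_inf a C := by
    rintro Γ ⟨hΓa, hΓC⟩
    refine mem_extent_iff.2 fun Δ s hΔ => ?_
    have hmem : (Γ ++ Δ, s) ∈ (sSup C).intent := by
      rw [Concept.intent_sSup, Set.mem_iInter₂]
      refine fun b hb => mem_intent_iff.2 fun Θ hΘ => ?_
      have hΘΓ : Θ ++ Γ ∈ (a ⊓ b).extent :=
        ⟨mem_extent_of_subset hE (List.subset_append_right _ _) hΓa,
          mem_extent_of_subset hE (List.subset_append_left _ _) hΘ⟩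
      rw [← List.append_assoc]
      exact mem_intent_iff.1
        (Concept.intent_subset_intent_iff.2 (le_iSup₂ (f := fun b _ => a ⊓ b) b hb) hΔ) _ hΘΓ
    exact hE (by simp) (mem_extent_iff.1 hΓC _ _ hmem)

end EntailmentConcept

end EntailmentConcepts

/-- The truth values of the canonical model: sets of lists of hypotheses, closed under entailment by
cut-free derivations and ordered by inclusion. -/
abbrev CutFreeConcept (Sym : ℕ → Type*) : Type _ :=
  EntailmentConcept (CutFreeProvable (Sym := Sym))

namespace CutFreeConcept

noncomputable instance : Order.Frame (CutFreeConcept Sym) :=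
  .ofMinimalAxioms (EntailmentConcept.frameMinimalAxioms CutFreeProvable.mono)

variable {a b : CutFreeConcept Sym} {A B : Formula Sym 0}

theorem mem_extent_of_subset {Γ Δ : List (Formula Sym 0)} (h : Γ ⊆ Δ) (hΓ : Γ ∈ a.extent) :
    Δ ∈ a.extent :=
  EntailmentConcept.mem_extent_of_subset (E := CutFreeProvable) CutFreeProvable.mono h hΓ

open EntailmentConcept

theorem provable_of_mem {Γ : List (Formula Sym 0)} {Λ : Option (Formula Sym 0)}
    (hΓ : Γ ∈ a.extent) (hΛ : ([], Λ) ∈ a.intent) : CutFreeProvable Γ Λ := by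
  simpa only [List.append_nil] using mem_extent_iff.1 hΓ [] Λ hΛ

/-- `a` is an admissible truth value of `A`: the lists of hypotheses in `a` prove `A`, and `A`
proves whatever follows from each of them. -/
structure Represents (a : CutFreeConcept Sym) (A : Formula Sym 0) : Prop where
  provable : ∀ {Γ}, Γ ∈ a.extent → CutFreeProvable Γ (some A)
  provable_cons : ∀ {Δ Λ}, (Δ, Λ) ∈ a.intent → CutFreeProvable (A :: Δ) Λ

namespace Represents

theorem singleton_mem (h : a.Represents A) : [A] ∈ a.extent :=
  mem_extent_iff.2 fun _ _ => h.provable_cons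

theorem cons_mem (h : a.Represents A) (Γ : List (Formula Sym 0)) : A :: Γ ∈ a.extent :=
  mem_extent_of_subset (by simp) h.singleton_mem

theorem mem_intent (h : a.Represents A) {Λ : Option (Formula Sym 0)}
    (hΛ : ∀ {Γ}, CutFreeProvable Γ (some A) → CutFreeProvable Γ Λ) : ([], Λ) ∈ a.intent :=
  mem_intent_iff.2 fun Γ hΓ => by simpa only [List.append_nil] using hΛ (h.provable hΓ)

theorem atom {k : ℕ} (R : Sym k) (v : Fin k → Var 0) :
    Represents (.ofAttribute _ ([], some (.atom R v))) (.atom R v) where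
  provable hΓ := by simpa using hΓ
  provable_cons h := mem_intent_iff.1 h [.atom R v] (by simpa using ⟨.ax _, trivial⟩)

theorem top : (⊤ : CutFreeConcept Sym).Represents .top where
  provable _ := CutFreeProvable.mono (List.nil_subset _) ⟨.topR, trivial⟩
  provable_cons h := mem_intent_iff.1 h [.top] trivial

theorem bot : (⊥ : CutFreeConcept Sym).Represents .bot where
  provable h := provable_of_mem h trivial
  provable_cons _ := .of_none _ (.mono (by simp) ⟨.botL, trivial⟩)

theorem and (hA : a.Represents A) (hB : b.Represents B) : (a ⊓ b).Represents (.and A B) where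
  provable := fun ⟨ha, hb⟩ =>
    let ⟨d, hd⟩ := hA.provable ha
    let ⟨e, he⟩ := hB.provable hb
    ⟨d.andR e, hd, he⟩
  provable_cons h :=
    mem_intent_iff.1 h [.and A B]
      ⟨mem_extent_iff.2 fun _ _ hΔ => let ⟨d, hd⟩ := hA.provable_cons hΔ; ⟨d.andL₁ B, hd⟩,
        mem_extent_iff.2 fun _ _ hΔ => let ⟨d, hd⟩ := hB.provable_cons hΔ; ⟨d.andL₂ A, hd⟩⟩

theorem or (hA : a.Represents A) (hB : b.Represents B) : (a ⊔ b).Represents (.or A B) where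
  provable hΓ := provable_of_mem hΓ
    ⟨hA.mem_intent fun ⟨d, hd⟩ => ⟨d.orR₁ B, hd⟩, hB.mem_intent fun ⟨d, hd⟩ => ⟨d.orR₂ A, hd⟩⟩
  provable_cons := fun ⟨ha, hb⟩ =>
    let ⟨d, hd⟩ := hA.provable_cons ha
    let ⟨e, he⟩ := hB.provable_cons hb
    ⟨d.orL e, hd, he⟩

theorem neg (hA : a.Represents A) : aᶜ.Represents (.neg A) where
  provable {Γ} hΓ := by
    have hbot : A :: Γ ∈ (⊥ : CutFreeConcept Sym).extent :=
      (compl_inf_self a).le ⟨mem_extent_of_subset (by simp) hΓ, hA.cons_mem Γ⟩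
    obtain ⟨d, hd⟩ := provable_of_mem (Λ := none) hbot trivial
    exact ⟨d.negR, hd⟩
  provable_cons {Δ Λ} h := by
    have hle : .ofObject _ [.neg A] ≤ aᶜ := by
      refine le_compl_iff_disjoint_right.2 (disjoint_iff_inf_le.2 ?_)
      rintro Γ ⟨hneg, hΓ⟩
      obtain ⟨d, hd⟩ := hA.provable hΓ
      refine mem_extent_iff.2 fun Δ Λ _ => ?_
      have h : CutFreeProvable (.neg A :: (Γ ++ Δ)) Λ :=
        .of_none Λ (.mono (by simp) ⟨d.negL, hd⟩)
      exact .mono (by simp) (mem_extent_ofObject_iff.1 hneg _ _ h)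
    exact mem_intent_iff.1 h _ (Concept.ofObjects_le_iff.1 hle rfl)

theorem imp (hA : a.Represents A) (hB : b.Represents B) : (a ⇨ b).Represents (.imp A B) where
  provable {Γ} hΓ := by
    have hmem : A :: Γ ∈ b.extent :=
      himp_inf_le (a := a) ⟨mem_extent_of_subset (by simp) hΓ, hA.cons_mem Γ⟩
    obtain ⟨d, hd⟩ := hB.provable hmem
    exact ⟨d.impR, hd⟩
  provable_cons {Δ Λ} h := by
    have hle : .ofObject _ [.imp A B] ≤ a ⇨ b := by
      refine le_himp_iff.2 ?_
      rintro Γ ⟨himp, hΓ⟩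
      obtain ⟨d, hd⟩ := hA.provable hΓ
      refine mem_extent_iff.2 fun Δ Λ hΔ => ?_
      obtain ⟨e, he⟩ := hB.provable_cons hΔ
      exact .mono (by simp) (mem_extent_ofObject_iff.1 himp _ _ ⟨d.impL e, hd, he⟩)
    exact mem_intent_iff.1 h _ (Concept.ofObjects_le_iff.1 hle rfl)

theorem all {f : ℕ → CutFreeConcept Sym} {F : Formula Sym 1}
    (hF : ∀ t, (f t).Represents (F.inst t)) : (⨅ t, f t).Represents (.all F) where
  provable {Γ} hΓ := by
    obtain ⟨t, ht, htΓ⟩ := F.exists_fresh Γ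
    obtain ⟨d, hd⟩ := (hF t).provable (iInf_le f t hΓ)
    exact ⟨d.allR F t htΓ ht, hd⟩
  provable_cons h := by
    refine mem_intent_iff.1 h [.all F] ?_
    rw [Concept.extent_iInf, Set.mem_iInter]
    refine fun t => mem_extent_iff.2 fun Δ Λ hΔ => ?_
    obtain ⟨d, hd⟩ := (hF t).provable_cons hΔ
    exact ⟨d.allL F t, hd⟩

theorem ex {f : ℕ → CutFreeConcept Sym} {F : Formula Sym 1}
    (hF : ∀ t, (f t).Represents (F.inst t)) : (⨆ t, f t).Represents (.ex F) where
  provable hΓ := by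
    refine provable_of_mem hΓ ?_
    rw [Concept.intent_iSup, Set.mem_iInter]
    exact fun t => (hF t).mem_intent fun ⟨d, hd⟩ => ⟨d.exR F t, hd⟩
  provable_cons {Δ Λ} h := by
    obtain ⟨t, ht, htΔΛ⟩ := F.exists_fresh (Δ ++ Λ.toList)
    rw [List.forall_mem_append] at htΔΛ
    rw [Concept.intent_iSup, Set.mem_iInter] at h
    obtain ⟨d, hd⟩ := (hF t).provable_cons (h t)
    have htΛ : ∀ G ∈ Λ, ¬ G.Occurs t := by simpa using htΔΛ.2
    exact ⟨d.exL F t ht htΔΛ.1 htΛ, hd⟩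

theorem isComplemented (hA : a.Represents A) (hprop : A.IsPropositional) : IsComplemented a := by
  refine ⟨aᶜ, disjoint_compl_right, codisjoint_iff_le_sup.2 fun Γ _ => ?_⟩
  refine mem_extent_iff.2 fun Δ Λ ⟨ha, hac⟩ => ?_
  obtain ⟨d, hd⟩ := hA.provable_cons ha
  obtain ⟨e, he⟩ := hA.neg.provable_cons hac
  exact .append_left Γ ⟨.neutralization A hprop d e, hd, he⟩

end Represents

end CutFreeConcept

namespace Formula

theorem sizeOf_inst_le (t : ℕ) : ∀ {n : ℕ} (A : Formula Sym (n + 1)), sizeOf (A.inst t) ≤ sizeOf A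
  | _, .atom _ _ | _, .top | _, .bot => by simp [inst]
  | _, .and A B | _, .or A B | _, .imp A B => by
    have hA := sizeOf_inst_le t A
    have hB := sizeOf_inst_le t B
    simp only [inst, and.sizeOf_spec, or.sizeOf_spec, imp.sizeOf_spec, sizeOf_nat]
    lia
  | _, .neg A | _, .all A | _, .ex A => by
    have hA := sizeOf_inst_le t A
    simp only [inst, neg.sizeOf_spec, all.sizeOf_spec, ex.sizeOf_spec, sizeOf_nat]
    lia

@[elab_as_elim]
theorem inst_induction {P : Formula Sym 0 → Prop}
    (atom : ∀ {k : ℕ} (R : Sym k) (v : Fin k → Var 0), P (.atom R v)) (top : P .top) (bot : P .bot)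
    (and : ∀ A B, P A → P B → P (.and A B)) (or : ∀ A B, P A → P B → P (.or A B))
    (neg : ∀ A, P A → P (.neg A)) (imp : ∀ A B, P A → P B → P (.imp A B))
    (all : ∀ F : Formula Sym 1, (∀ t, P (F.inst t)) → P (.all F))
    (ex : ∀ F : Formula Sym 1, (∀ t, P (F.inst t)) → P (.ex F)) (A : Formula Sym 0) : P A := by
  induction hk : sizeOf A using Nat.strong_induction_on generalizing A with
  | _ k ih =>
    have of_sizeOf_lt (B : Formula Sym 0) (h : sizeOf B < sizeOf A) : P B := ih _ (hk ▸ h) B rfl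
    have of_inst (F : Formula Sym 1) (h : sizeOf F < sizeOf A) (t : ℕ) : P (F.inst t) :=
      of_sizeOf_lt _ ((F.sizeOf_inst_le t).trans_lt h)
    cases A with
    | atom R v => exact atom R v
    | top => exact top
    | bot => exact bot
    | and A B => exact and A B (of_sizeOf_lt A (by simp +arith)) (of_sizeOf_lt B (by simp))
    | or A B => exact or A B (of_sizeOf_lt A (by simp +arith)) (of_sizeOf_lt B (by simp))
    | neg A => exact neg A (of_sizeOf_lt A (by simp))
    | imp A B => exact imp A B (of_sizeOf_lt A (by simp +arith)) (of_sizeOf_lt B (by simp))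
    | all F => exact all F (of_inst F (by simp))
    | ex F => exact ex F (of_inst F (by simp))

end Formula

/-! ### Cut elimination -/

/-- The term model of cut-free provability: its elements are the free variables, and the value of an
atomic formula consists of the lists of hypotheses which prove it. -/
def canonicalInterpretation (Sym : ℕ → Type*) : Interpretation Sym ℕ (CutFreeConcept Sym) where
  rel R v := .ofAttribute _ ([], some (.atom R fun i => .free (v i)))

theorem canonicalInterpretation_isNeutral : (canonicalInterpretation Sym).IsNeutral :=
  fun P v => (CutFreeConcept.Represents.atom P fun i => .free (v i)).isComplemented rfl

open CutFreeConcept in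
theorem represents_eval_canonicalInterpretation (A : Formula Sym 0) :
    Represents ((canonicalInterpretation Sym).eval id A ![]) A := by
  induction A using Formula.inst_induction with
  | atom R v =>
    have hv : (fun i => .free ((v i).eval id ![])) = v := by
      ext i
      cases v i with
      | free a => rfl
      | bound j => exact j.elim0
    simpa only [Interpretation.eval, canonicalInterpretation, hv] using! Represents.atom R v
  | top => exact .top
  | bot => exact .bot
  | and A B hA hB => exact hA.and hB
  | or A B hA hB => exact hA.or hB
  | neg A hA => exact hA.neg
  | imp A B hA hB => exact hA.imp hB
  | all F hF =>
    rw [Interpretation.eval_all]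
    exact .all fun t => by simpa [Interpretation.eval_inst] using hF t
  | ex F hF =>
    rw [Interpretation.eval_ex]
    exact .ex fun t => by simpa [Interpretation.eval_inst] using hF t

theorem Derivation.exists_cutFree {Γ : List (Formula Sym 0)} {Λ : Option (Formula Sym 0)}
    (d : Derivation Γ Λ) : ∃ e : Derivation Γ Λ, e.CutFree := by
  have hle := d.evalAntecedent_le_evalSuccedent canonicalInterpretation_isNeutral id
  have hΓ : Γ ∈ ((canonicalInterpretation Sym).evalAntecedent id Γ).extent := by
    simp only [Interpretation.evalAntecedent, Concept.extent_iInf, Set.mem_iInter]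
    exact fun G hG => CutFreeConcept.mem_extent_of_subset (by simpa using hG)
      (represents_eval_canonicalInterpretation G).singleton_mem
  have hΛ : ([], Λ) ∈ ((canonicalInterpretation Sym).evalSuccedent id Λ).intent := by
    simp only [Interpretation.evalSuccedent, Concept.intent_iSup, Set.mem_iInter]
    rintro G rfl
    exact (represents_eval_canonicalInterpretation G).mem_intent id
  exact CutFreeConcept.provable_of_mem (hle hΓ) hΛ

/-! ### Witnesses -/

theorem Derivation.consistent (d : Derivation (Sym := Sym) [] none) : False := by
  let I : Interpretation Sym Unit Prop := ⟨fun _ _ => True⟩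
  have hI : I.IsNeutral := fun _ _ => isComplemented_top
  simpa using d.evalAntecedent_le_evalSuccedent hI fun _ => ()

theorem Derivation.finite_setOf_hasWitness (A : Formula Sym 1) {Γ : List (Formula Sym 0)}
    {Λ : Option (Formula Sym 0)} (d : Derivation Γ Λ) : {t | d.HasWitness A t}.Finite := by
  induction d with
  | ax | topR | botL => exact Set.finite_empty
  | thinL _ _ ih | thinR _ _ ih | contr _ ih | exch _ ih | andL₁ _ _ ih | andL₂ _ _ ih
  | orR₁ _ _ ih | orR₂ _ _ ih | negR _ ih | negL _ ih | impR _ ih | allR _ _ _ _ _ ih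
  | allL _ _ _ ih | exL _ _ _ _ _ _ ih => exact ih
  | cut _ _ ihd ihe | andR _ _ ihd ihe | orL _ _ ihd ihe | impL _ _ ihd ihe
  | neutralization _ _ _ _ ihd ihe => exact ihd.union ihe
  | exR F a _ ih =>
    exact ((Set.finite_singleton a).subset fun t ht => ht.2.symm).union ih

theorem Derivation.nonempty_of_hasWitness {A : Formula Sym 1} {Γ : List (Formula Sym 0)}
    {Λ Λ' : Option (Formula Sym 0)} (d : Derivation Γ Λ) (hd : d.CutFree)
    (hΓ : ∀ G ∈ Γ, G.IsPropositional) (hΛ : Λ = some (.ex A))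
    (h : ∀ t, d.HasWitness A t → Nonempty (Derivation [A.inst t] Λ')) :
    Nonempty (Derivation Γ Λ') := by
  induction d <;>
    simp only [List.forall_mem_cons, List.forall_mem_append, Formula.IsPropositional, HasWitness,
      CutFree, or_imp, forall_and, Option.some.injEq, reduceCtorEq, false_and] at *
  case ax => subst hΛ; exact hΓ.1.elim
  case thinL ih => exact (ih hd hΓ.2 hΛ h).map (.thinL _)
  case thinR d _ =>
    cases Λ' with
    | none => exact ⟨d⟩
    | some B => exact ⟨d.thinR B⟩
  case contr ih => exact (ih hd ⟨hΓ.1, hΓ⟩ hΛ h).map .contr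
  case exch ih => exact (ih hd ⟨hΓ.1, hΓ.2.2.1, hΓ.2.1, hΓ.2.2.2⟩ hΛ h).map .exch
  case andL₁ ih => exact (ih hd ⟨hΓ.1.1, hΓ.2⟩ hΛ h).map (.andL₁ _)
  case andL₂ ih => exact (ih hd ⟨hΓ.1.2, hΓ.2⟩ hΛ h).map (.andL₂ _)
  case orL ihd ihe =>
    exact .map2 .orL (ihd hd.1 ⟨hΓ.1.1, hΓ.2⟩ hΛ h.1) (ihe hd.2 ⟨hΓ.1.2, hΓ.2⟩ hΛ h.2)
  case impL d _ _ ihe => exact (ihe hd.2 ⟨hΓ.1.2, hΓ.2.2⟩ hΛ h.2).map (.impL d)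
  case exR d _ =>
    obtain rfl : _ = A := by simpa using hΛ
    exact (h.1 _ ⟨rfl, rfl⟩).map fun e => by simpa using d.cut e
  case neutralization N hN _ _ ihd ihe =>
    exact .map2 (.neutralization N hN) (ihd hd.1 ⟨hN, hΓ⟩ hΛ h.1) (ihe hd.2 ⟨hN, hΓ⟩ hΛ h.2)

theorem Formula.nonempty_derivation_disj {A : Formula Sym 1} {s t : ℕ} {ts : List ℕ}
    (hs : s ∈ t :: ts) : Nonempty (Derivation [A.inst s] (some (A.disj t ts))) := by
  induction ts generalizing t with
  | nil => obtain rfl := List.mem_singleton.1 hs; exact ⟨.ax _⟩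
  | cons t' ts ih =>
    rcases List.mem_cons.1 hs with rfl | hs
    · exact ⟨(Derivation.ax _).orR₁ _⟩
    · exact (ih hs).map (.orR₂ _)

theorem Derivation.exists_derivable_disj {A : Formula Sym 1} (d : Derivation [] (some (.ex A)))
    (hd : d.CutFree) : ∃ (t : ℕ) (ts : List ℕ), (∀ s ∈ t :: ts, d.HasWitness A s) ∧
      Derivable (A.disj t ts) := by
  have hreplace (Λ : Option (Formula Sym 0)) := d.nonempty_of_hasWitness (Λ' := Λ) hd (by simp) rfl
  obtain ⟨L, hL⟩ : ∃ L : List ℕ, ∀ s, s ∈ L ↔ d.HasWitness A s :=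
    ⟨(d.finite_setOf_hasWitness A).toFinset.toList, by simp⟩
  cases L with
  | nil =>
    obtain ⟨e⟩ := hreplace none fun s hs => (List.not_mem_nil ((hL s).2 hs)).elim
    exact e.consistent.elim
  | cons t ts =>
    exact ⟨t, ts, fun s => (hL s).1,
      hreplace _ fun s hs => Formula.nonempty_derivation_disj ((hL s).2 hs)⟩

end LJPlus

theorem mainTheorem6 {Sym : ℕ → Type*} (A : LJPlus.Formula Sym 1)
    (h : LJPlus.Derivable (.ex A)) :
    (∃ (t : ℕ) (ts : List ℕ), LJPlus.Derivable (A.disj t ts)) ∧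
    (∃ d : LJPlus.Derivation [] (some (.ex A)), d.CutFree) ∧
    (∀ d : LJPlus.Derivation [] (some (.ex A)), d.CutFree →
      ∃ (t : ℕ) (ts : List ℕ), (∀ s ∈ t :: ts, d.HasWitness A s) ∧
        LJPlus.Derivable (A.disj t ts)) := by
  obtain ⟨d⟩ := h
  obtain ⟨e, he⟩ := d.exists_cutFree
  obtain ⟨t, ts, -, hdisj⟩ := e.exists_derivable_disj he
  exact ⟨⟨t, ts, hdisj⟩, ⟨e, he⟩, fun d hd => d.exists_derivable_disj hd⟩
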